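/- Let $\mathcal{X}$ and $\mathcal{Y}$ be complex Hilbert spaces of the same finite dimension $d$, and write $L(\mathcal{X})$, $L(\mathcal{Y})$ for the spaces of linear operators on them. Let $\Phi : L(\mathcal{X}) \to L(\mathcal{Y})$ be a doubly stochastic channel, that is, a linear map that is completely positive, trace-preserving, and unital ($\Phi(\mathbb{1}_{\mathcal{X}}) = \mathbb{1}_{\mathcal{Y}}$), and let $\Omega : L(\mathcal{X}) \to L(\mathcal{Y})$, $\Omega(A) = \frac{\operatorname{Tr}(A)}{d}\,\mathbb{1}_{\mathcal{Y}}$, be the completely depolarizing channel. Then for every real $p$ with $0 \le p \le 1/(d^2-1)$ (for $d = 1$, where the upper bound is read as $+\infty$: for every $p \ge 0$), the map \[ p\,\Phi + (1-p)\,\Omega \] is a mixed-unitary channel: there are a positive integer $N$, unitary maps $U_1,\dots,U_N : \mathcal{X} \to \mathcal{Y}$ and a probability distribution $(q_1,\dots,q_N)$ such that \[ p\,\Phi(A) + (1-p)\,\Omega(A) = \sum_{i=1}^N q_i\, U_i A U_i^{*} \qquad \text{for all } A \in L(\mathcal{X}). \] -/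

import Mathlib

noncomputable section QuantumChannels

variable {X Y : Type*}
  [NormedAddCommGroup X] [InnerProductSpace ℂ X] [FiniteDimensional ℂ X] [CompleteSpace X]
  [NormedAddCommGroup Y] [InnerProductSpace ℂ Y] [FiniteDimensional ℂ Y] [CompleteSpace Y]

/-- A super-operator `Φ : L(X) → L(Y)` is completely positive, in Mathlib's sense: applying `Φ`
to all entries of a positive `k × k` operator matrix gives a positive operator matrix,
for every `k`. -/
def IsCompletelyPositive (Φ : (X →L[ℂ] X) →ₗ[ℂ] (Y →L[ℂ] Y)) : Prop :=
  ∃ F : CompletelyPositiveMap (X →L[ℂ] X) (Y →L[ℂ] Y), F.toLinearMap = Φ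

/-- `Φ` preserves the trace. -/
def IsTracePreserving (Φ : (X →L[ℂ] X) →ₗ[ℂ] (Y →L[ℂ] Y)) : Prop :=
  ∀ A : X →L[ℂ] X,
    LinearMap.trace ℂ Y (Φ A : Y →ₗ[ℂ] Y) = LinearMap.trace ℂ X (A : X →ₗ[ℂ] X)

/-- A doubly stochastic channel: completely positive, trace-preserving and unital. -/
structure IsDoublyStochastic (Φ : (X →L[ℂ] X) →ₗ[ℂ] (Y →L[ℂ] Y)) : Prop where
  completelyPositive : IsCompletelyPositive Φ
  tracePreserving : IsTracePreserving Φ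
  unital : Φ 1 = 1

/-- A mixed-unitary channel: a finite convex combination `A ↦ ∑ i, q i • U i A (U i)⋆` of
conjugations by unitary maps `U i : X → Y`. -/
def IsMixedUnitary (Φ : (X →L[ℂ] X) →ₗ[ℂ] (Y →L[ℂ] Y)) : Prop :=
  ∃ (N : ℕ) (q : Fin N → ℝ) (U : Fin N → (X ≃ₗᵢ[ℂ] Y)),
    (∀ i, 0 ≤ q i) ∧ ∑ i, q i = 1 ∧
      ∀ A : X →L[ℂ] X, Φ A = ∑ i, q i •
        ((U i : X →L[ℂ] Y) ∘L A ∘L ContinuousLinearMap.adjoint (U i : X →L[ℂ] Y))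

/-- The completely depolarizing channel `A ↦ (Tr A / dim Y) • 1`. -/
def completelyDepolarizing (X Y : Type*)
    [NormedAddCommGroup X] [InnerProductSpace ℂ X]
    [NormedAddCommGroup Y] [InnerProductSpace ℂ Y] :
    (X →L[ℂ] X) →ₗ[ℂ] (Y →L[ℂ] Y) where
  toFun A := (LinearMap.trace ℂ X (A : X →ₗ[ℂ] X) / (Module.finrank ℂ Y : ℂ)) • 1
  map_add' A B := by simp [add_div, add_smul]
  map_smul' c A := by simp [mul_div_assoc, mul_smul]

end QuantumChannels

/-! The endpoint `p = 1/(d²-1)` is an explicit average over the unitary group. Identify `Y` with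
`X`, write `E_ij` for the matrix units of an orthonormal basis `b`, and weight `u` by `f(u) = ∑ ⟨u
b_i, Φ(E_ij) u b_j⟩`. Complete positivity gives `f ≥ 0`. For `d ≥ 2`, Haar integration yields `∫
f(u) u C u⋆ du = k Φ(C) + (1-k) Ω(C)` with `k = 1/(d²-1)`, and `∫ f = 1`.

The integral (`integral_conjOverlap_smul`) reduces to the maps `A ↦ ∫ Tr(B u⋆ A u) u C u⋆ du`. These
commute with unitary conjugation, hence have the form `s A + t Tr(A) 1`
(`IsUnitarilyEquivariant.exists_eq`), and two traces determine `s` and `t`.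

The convex hull of the unitary conjugations is compact, so it contains the average, which is thus a
finite mixture. Taking `Φ = Ω` puts `Ω` itself in the hull, and smaller `p` follow by convexity. -/

open InnerProductSpace in
theorem rankOne_reflection_mem_unitary {X : Type*} [NormedAddCommGroup X] [InnerProductSpace ℂ X]
    [CompleteSpace X] {y : X} (hy : ‖y‖ = 1) :
    (1 - (2 : ℂ) • rankOne ℂ y y : X →L[ℂ] X) ∈ unitary (X →L[ℂ] X) := by
  have h1 : star (rankOne ℂ y y) = rankOne ℂ y y := by
    rw [ContinuousLinearMap.star_eq_adjoint, adjoint_rankOne]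
  have h2 : rankOne ℂ y y * rankOne ℂ y y = rankOne ℂ y y := isIdempotentElem_rankOne_self hy
  have h3 : star (1 - (2 : ℂ) • rankOne ℂ y y : X →L[ℂ] X) = 1 - (2 : ℂ) • rankOne ℂ y y := by
    simp [star_smul, h1]
  have h4 : (1 - (2 : ℂ) • rankOne ℂ y y : X →L[ℂ] X) * (1 - (2 : ℂ) • rankOne ℂ y y) = 1 := by
    simp only [mul_sub, sub_mul, one_mul, mul_one, smul_mul_assoc, mul_smul_comm, h2]
    module
  exact ⟨by rw [h3, h4], by rw [h3, h4]⟩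

/-- `R` intertwines the conjugation action of the unitary group with itself. -/
def IsUnitarilyEquivariant {X : Type*} [NormedAddCommGroup X] [InnerProductSpace ℂ X]
    [CompleteSpace X] (R : (X →L[ℂ] X) →ₗ[ℂ] (X →L[ℂ] X)) : Prop :=
  ∀ u : unitary (X →L[ℂ] X), ∀ A : X →L[ℂ] X,
    R ((u : X →L[ℂ] X) * A * star (u : X →L[ℂ] X)) = u * R A * star (u : X →L[ℂ] X)

/-! ### Linear maps commuting with unitary conjugation. -/

section Commutant

variable {X : Type*} [NormedAddCommGroup X] [InnerProductSpace ℂ X] [CompleteSpace X]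
  {R : (X →L[ℂ] X) →ₗ[ℂ] (X →L[ℂ] X)}

open InnerProductSpace

theorem unitary_conj_rankOne (u : X →L[ℂ] X) (x y : X) :
    u * rankOne ℂ x y * star u = rankOne ℂ (u x) (u y) := by
  rw [ContinuousLinearMap.star_eq_adjoint, ContinuousLinearMap.mul_def,
    ContinuousLinearMap.mul_def, comp_rankOne, rankOne_comp, ContinuousLinearMap.adjoint_adjoint]

theorem IsUnitarilyEquivariant.commute_of_fixed (hR : IsUnitarilyEquivariant R)
    (u : unitary (X →L[ℂ] X)) {A : X →L[ℂ] X}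
    (h : (u : X →L[ℂ] X) * A * star (u : X →L[ℂ] X) = A) :
    (u : X →L[ℂ] X) * R A = R A * u := by
  have h1 := hR u A
  rw [h] at h1
  conv_rhs => rw [h1]
  rw [mul_assoc, Unitary.coe_star_mul_self, mul_one]

/-- The reflection in `y` fixes or negates `x`, so it fixes the projection onto `x` and commutes
with its image under `R`. That image therefore preserves the `-1` eigenspace of the reflection, the
line through `y`. -/
theorem IsUnitarilyEquivariant.apply_rankOne_self_apply (hR : IsUnitarilyEquivariant R)
    {x y : X} (hy : ‖y‖ = 1) (hxy : inner ℂ x y = 0 ∨ x = y) :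
    R (rankOne ℂ x x) y = inner ℂ y (R (rankOne ℂ x x) y) • y := by
  set T := R (rankOne ℂ x x)
  have hyy : inner ℂ y y = (1 : ℂ) := by simp [inner_self_eq_norm_sq_to_K, hy]
  have h := hR.commute_of_fixed ⟨_, rankOne_reflection_mem_unitary hy⟩ (A := rankOne ℂ x x) (by
    rw [unitary_conj_rankOne]
    rcases hxy with h | rfl
    · have : inner ℂ y x = (0 : ℂ) := by rw [← inner_conj_symm, h, map_zero]
      simp [this]
    · have h1 : (1 - (2 : ℂ) • rankOne ℂ x x : X →L[ℂ] X) x = -x := by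
        simp [hy]
        module
      simp only [h1, map_neg, neg_apply, neg_neg])
  have h2 := congrArg (fun S : X →L[ℂ] X => S y) h
  simp only [mul_apply_eq_comp, sub_apply,
    one_apply_eq_self, smul_apply, rankOne_apply, map_sub,
    map_smul, hyy, one_smul] at h2
  have h3 : (2 : ℂ) • (inner ℂ y (T y) • y) = (2 : ℂ) • T y := sub_right_injective h2
  exact (smul_right_injective X (two_ne_zero' ℂ) h3).symm

theorem IsUnitarilyEquivariant.exists_apply_rankOne_self (hR : IsUnitarilyEquivariant R)
    {x : X} (hx : ‖x‖ = 1) :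
    ∃ a b : ℂ, R (rankOne ℂ x x) = a • rankOne ℂ x x + b • 1 := by
  set T := R (rankOne ℂ x x) with hT
  have hxx : inner ℂ x x = (1 : ℂ) := by simp [inner_self_eq_norm_sq_to_K, hx]
  have hTx := hR.apply_rankOne_self_apply hx (Or.inr (rfl : x = x))
  rw [← hT] at hTx
  have key : ∀ z : X, inner ℂ x z = (0 : ℂ) → ∃ c : ℂ, T z = c • z := by
    intro z hz
    rcases eq_or_ne z 0 with rfl | hz0
    · exact ⟨0, by simp⟩
    have hn : ((‖z‖ : ℝ) : ℂ) ≠ 0 := by simpa using hz0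
    have h := hR.apply_rankOne_self_apply (x := x) (y := ((‖z‖ : ℝ) : ℂ)⁻¹ • z)
      (by rw [norm_smul]; simp [hz0]) (Or.inl (by rw [inner_smul_right, hz, mul_zero]))
    rw [← hT, map_smul, smul_comm] at h
    exact ⟨_, smul_right_injective X (inv_ne_zero hn) h⟩
  let K : Submodule ℂ X := LinearMap.ker (innerSL ℂ x : X →ₗ[ℂ] ℂ)
  have memK : ∀ z, z ∈ K ↔ inner ℂ x z = (0 : ℂ) := fun z => by simp [K]
  have hmap : ∀ z ∈ K, (T : X →ₗ[ℂ] X) z ∈ K := by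
    intro z hz
    obtain ⟨c, hc⟩ := key z ((memK z).1 hz)
    simpa [hc] using K.smul_mem c hz
  -- Every vector orthogonal to `x` is an eigenvector of `T`, so `T` is a single scalar on that
  -- complement.
  obtain ⟨b, hb⟩ := LinearMap.exists_eq_smul_id_of_forall_notLinearIndependent
    (f := (T : X →ₗ[ℂ] X).restrict hmap) (by
      intro v hv
      obtain ⟨c, hc⟩ := key v ((memK v).1 v.2)
      rw [LinearIndependent.pair_iff] at hv
      have := hv c (-1) (by ext; simp [hc])
      simp at this)
  have hb' : ∀ z, inner ℂ x z = (0 : ℂ) → T z = b • z := by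
    intro z hz
    have := congrArg (fun f => ((f ⟨z, (memK z).2 hz⟩ : K) : X)) hb
    simpa using this
  refine ⟨inner ℂ x (T x) - b, b, ?_⟩
  ext z
  have hz := hb' (z - inner ℂ x z • x) (by rw [inner_sub_right, inner_smul_right, hxx, mul_one, sub_self])
  rw [map_sub, map_smul, hTx] at hz
  have : T z = b • (z - inner ℂ x z • x) + inner ℂ x z • inner ℂ x (T x) • x := by
    rw [← hz]; abel
  rw [this]
  simp
  module

theorem exists_unitary_apply_eq [FiniteDimensional ℂ X] {x y : X} (hx : ‖x‖ = 1) (hy : ‖y‖ = 1) :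
    ∃ u : unitary (X →L[ℂ] X), (u : X →L[ℂ] X) x = y := by
  have hpos : 0 < Module.finrank ℂ X := Module.finrank_pos_iff_exists_ne_zero.2
    ⟨x, fun h => by simp [h] at hx⟩
  have ext : ∀ z : X, ‖z‖ = 1 →
      ∃ b : OrthonormalBasis (Fin (Module.finrank ℂ X)) ℂ X, b ⟨0, hpos⟩ = z := by
    intro z hz
    obtain ⟨b, hb⟩ := Orthonormal.exists_orthonormalBasis_extension_of_card_eq (𝕜 := ℂ)
      (ι := Fin (Module.finrank ℂ X)) (by simp) (v := fun _ => z) (s := {⟨0, hpos⟩})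
      ⟨fun _ => hz, fun i j hij => absurd (Subsingleton.elim i j) hij⟩
    exact ⟨b, hb _ rfl⟩
  obtain ⟨b, hb⟩ := ext x hx
  obtain ⟨c, hc⟩ := ext y hy
  refine ⟨Unitary.linearIsometryEquiv.symm (b.equiv c (Equiv.refl _)), ?_⟩
  rw [← hb, ← hc]
  simp

/-- Polarization: the vectors `x + y` and `x + i y` show that the sesquilinear form `S (rankOne ℂ x
y)` vanishes off the diagonal too, and rank-one operators span. -/
theorem eq_zero_of_rankOne_self [FiniteDimensional ℂ X] {V : Type*} [AddCommGroup V] [Module ℂ V]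
    {S : (X →L[ℂ] X) →ₗ[ℂ] V} (h : ∀ x : X, ‖x‖ = 1 → S (rankOne ℂ x x) = 0) : S = 0 := by
  have h1 : ∀ x : X, S (rankOne ℂ x x) = 0 := by
    intro x
    rcases eq_or_ne x 0 with rfl | hx
    · simp
    have hn : ((‖x‖ : ℝ) : ℂ) ≠ 0 := by simpa using hx
    have := h (((‖x‖ : ℝ) : ℂ)⁻¹ • x) (by rw [norm_smul]; simp [hx])
    simpa [hx] using this
  have h2 : ∀ x y : X, S (rankOne ℂ x y) = 0 := by
    intro x y
    have e1 := h1 (x + y)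
    have e2 := h1 (x + Complex.I • y)
    simp only [map_add, add_apply, map_smul, map_smulₛₗ,
      smul_apply, Complex.conj_I, h1, smul_zero, zero_add, add_zero] at e1 e2
    have e3 : S (rankOne ℂ y x) = - S (rankOne ℂ x y) := eq_neg_of_add_eq_zero_right (by
      first | exact e1 | (rw [add_comm]; exact e1))
    rw [e3] at e2
    have e4 : ((2 : ℂ) * Complex.I) • S (rankOne ℂ x y) = 0 := by
      rw [← neg_eq_zero, ← e2]; module
    simpa using e4
  let b := stdOrthonormalBasis ℂ X
  ext A
  have : A = ∑ i, rankOne ℂ (A (b i)) (b i) := by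
    conv_lhs => rw [← ContinuousLinearMap.comp_id A, ← b.sum_rankOne_eq_id]
    simp [ContinuousLinearMap.comp_finsetSum, comp_rankOne]
  rw [this, map_sum]
  simp [h2]

theorem IsUnitarilyEquivariant.exists_eq [FiniteDimensional ℂ X] (hR : IsUnitarilyEquivariant R) :
    ∃ a b : ℂ, ∀ A : X →L[ℂ] X,
      R A = a • A + (b * LinearMap.trace ℂ X (A : X →ₗ[ℂ] X)) • (1 : X →L[ℂ] X) := by
  rcases subsingleton_or_nontrivial X with hX | hX
  · exact ⟨0, 0, fun A => by ext z; exact Subsingleton.elim _ _⟩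
  obtain ⟨x, hx⟩ := exists_norm_eq X zero_le_one
  obtain ⟨a, b, hab⟩ := hR.exists_apply_rankOne_self hx
  refine ⟨a, b, ?_⟩
  let D : (X →L[ℂ] X) →ₗ[ℂ] (X →L[ℂ] X) :=
    { toFun := fun A => a • A + (b * LinearMap.trace ℂ X (A : X →ₗ[ℂ] X)) • (1 : X →L[ℂ] X)
      map_add' := fun A B => by simp [mul_add, add_smul]; abel
      map_smul' := fun c A => by simp [smul_smul]; ring_nf }
  -- Unitaries act transitively on the unit sphere, so `a` and `b` found at `x` serve every unit
  -- vector `y`.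
  have : R - D = 0 := eq_zero_of_rankOne_self (fun y hy => by
    obtain ⟨u, hu⟩ := exists_unitary_apply_eq hx hy
    have h1 := hR u (rankOne ℂ x x)
    rw [unitary_conj_rankOne, hu, hab] at h1
    have hyy : inner ℂ y y = (1 : ℂ) := by simp [inner_self_eq_norm_sq_to_K, hy]
    rw [LinearMap.sub_apply, h1]
    simp [D, trace_rankOne, mul_add, add_mul, unitary_conj_rankOne, hu, hy])
  intro A
  have h2 := congrArg (fun f => f A) this
  simpa [sub_eq_zero, D] using h2

end Commutant

/-! ### Haar averages over the unitary group. -/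

section HaarTwirl

open InnerProductSpace MeasureTheory

variable {X : Type*} [NormedAddCommGroup X] [InnerProductSpace ℂ X] [FiniteDimensional ℂ X]
  [CompleteSpace X]

theorem compactSpace_unitary : CompactSpace (unitary (X →L[ℂ] X)) := by
  refine (isCompact_iff_compactSpace (s := (unitary (X →L[ℂ] X) : Set (X →L[ℂ] X)))).1 ?_
  refine Metric.isCompact_of_isClosed_isBounded isClosed_unitary
    ((Metric.isBounded_closedBall (x := (0 : X →L[ℂ] X)) (r := 1)).subset fun u hu => ?_)
  rcases subsingleton_or_nontrivial (X →L[ℂ] X) with h | h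
  · simp [Subsingleton.elim u 0]
  · simp [CStarRing.norm_of_mem_unitary hu]

theorem exists_invariant_probability_unitary :
    ∃ μ : Measure (unitary (X →L[ℂ] X)), IsProbabilityMeasure μ ∧ μ.IsMulLeftInvariant := by
  have := compactSpace_unitary (X := X)
  refine ⟨Measure.haarMeasure ⊤, ⟨?_⟩, inferInstance⟩
  exact Measure.haarMeasure_self (K₀ := (⊤ : TopologicalSpace.PositiveCompacts _))

theorem integrable_unitary_of_continuous {E : Type*} [NormedAddCommGroup E]
    (μ : Measure (unitary (X →L[ℂ] X))) [IsFiniteMeasure μ]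
    {f : unitary (X →L[ℂ] X) → E} (hf : Continuous f) : Integrable f μ := by
  have := compactSpace_unitary (X := X)
  exact hf.integrable_of_hasCompactSupport (HasCompactSupport.of_compactSpace f)

/-- The trace of an operator, as a continuous functional. -/
noncomputable def opTrace (X : Type*) [NormedAddCommGroup X] [InnerProductSpace ℂ X]
    [FiniteDimensional ℂ X] : (X →L[ℂ] X) →L[ℂ] ℂ :=
  LinearMap.toContinuousLinearMap (LinearMap.trace ℂ X ∘ₗ ContinuousLinearMap.coeLM ℂ)

omit [CompleteSpace X] in
theorem opTrace_apply (A : X →L[ℂ] X) :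
    opTrace X A = LinearMap.trace ℂ X (A : X →ₗ[ℂ] X) := rfl

omit [CompleteSpace X] in
theorem opTrace_mul_comm (A B : X →L[ℂ] X) : opTrace X (A * B) = opTrace X (B * A) := by
  simp only [opTrace_apply]
  exact LinearMap.trace_mul_comm ℂ (A : X →ₗ[ℂ] X) B

omit [CompleteSpace X] in
theorem opTrace_one : opTrace X 1 = Module.finrank ℂ X := by
  simp only [opTrace_apply]
  exact LinearMap.trace_one ℂ X

omit [CompleteSpace X] in
theorem opTrace_eq_sum {ι : Type*} [Fintype ι] (b : OrthonormalBasis ι ℂ X) (A : X →L[ℂ] X) :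
    opTrace X A = ∑ i, inner ℂ (b i) (A (b i)) :=
  LinearMap.trace_eq_sum_inner _ b

omit [CompleteSpace X] in
theorem opTrace_rankOne (x y : X) : opTrace X (rankOne ℂ x y) = inner ℂ y x :=
  trace_rankOne x y

theorem opTrace_unitary_conj (u : unitary (X →L[ℂ] X)) (A : X →L[ℂ] X) :
    opTrace X (u * A * star (u : X →L[ℂ] X)) = opTrace X A := by
  rw [opTrace_mul_comm, ← mul_assoc, Unitary.coe_star_mul_self, one_mul]

omit [CompleteSpace X] in
theorem opTrace_rankOne_mul (x y : X) (A : X →L[ℂ] X) :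
    opTrace X (rankOne ℂ x y * A) = inner ℂ y (A x) := by
  rw [opTrace_mul_comm, ContinuousLinearMap.mul_def, comp_rankOne, opTrace_rankOne]

@[fun_prop]
theorem continuous_unitary_conj_kernel (A B C : X →L[ℂ] X) :
    Continuous fun u : unitary (X →L[ℂ] X) =>
      opTrace X (B * (star (u : X →L[ℂ] X) * A * u)) • (u * C * star (u : X →L[ℂ] X)) := by
  fun_prop

/-- The average over the unitary group of `A ↦ Tr (B u⋆ A u) u C u⋆`. -/
noncomputable def unitaryTwirl (μ : Measure (unitary (X →L[ℂ] X))) [IsFiniteMeasure μ]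
    (B C : X →L[ℂ] X) : (X →L[ℂ] X) →ₗ[ℂ] (X →L[ℂ] X) where
  toFun A := ∫ u : unitary (X →L[ℂ] X),
    opTrace X (B * (star (u : X →L[ℂ] X) * A * u)) • (u * C * star (u : X →L[ℂ] X)) ∂μ
  map_add' A A' := by
    rw [← integral_add (integrable_unitary_of_continuous μ (by fun_prop))
      (integrable_unitary_of_continuous μ (by fun_prop))]
    simp only [mul_add, add_mul, map_add, add_smul]
  map_smul' c A := by
    rw [RingHom.id_apply, ← integral_smul]
    simp only [mul_smul_comm, smul_mul_assoc, map_smul, smul_assoc]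

variable (μ : Measure (unitary (X →L[ℂ] X)))

theorem unitaryTwirl_apply [IsFiniteMeasure μ] (A B C : X →L[ℂ] X) :
    unitaryTwirl μ B C A = ∫ u : unitary (X →L[ℂ] X),
      opTrace X (B * (star (u : X →L[ℂ] X) * A * u)) • (u * C * star (u : X →L[ℂ] X)) ∂μ :=
  rfl

theorem map_unitaryTwirl [IsFiniteMeasure μ] {E : Type*} [NormedAddCommGroup E] [NormedSpace ℂ E]
    [CompleteSpace E] (L : (X →L[ℂ] X) →L[ℂ] E) (A B C : X →L[ℂ] X) :
    L (unitaryTwirl μ B C A) = ∫ u : unitary (X →L[ℂ] X),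
      opTrace X (B * (star (u : X →L[ℂ] X) * A * u)) • L (u * C * star (u : X →L[ℂ] X)) ∂μ := by
  rw [unitaryTwirl_apply,
    ← L.integral_comp_comm (integrable_unitary_of_continuous μ (by fun_prop))]
  simp only [map_smul]

theorem isUnitarilyEquivariant_unitaryTwirl [IsFiniteMeasure μ] [μ.IsMulLeftInvariant]
    (B C : X →L[ℂ] X) : IsUnitarilyEquivariant (unitaryTwirl μ B C) := by
  intro v A
  have h := map_unitaryTwirl μ ((ContinuousLinearMap.mul ℂ (X →L[ℂ] X)).flip (star (v : X →L[ℂ] X))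
    ∘L ContinuousLinearMap.mul ℂ (X →L[ℂ] X) v) A B C
  simp only [ContinuousLinearMap.comp_apply, ContinuousLinearMap.flip_apply,
    ContinuousLinearMap.mul_apply'] at h
  -- Substituting `v * u` for `u` on the left-hand side cancels `v` inside the trace and leaves it
  -- outside.
  rw [h, unitaryTwirl_apply, ← integral_mul_left_eq_self _ v]
  congr 1
  ext1 u
  have h1 : star (v : X →L[ℂ] X) * v = 1 := Unitary.coe_star_mul_self v
  have h2 : star ((v * u : unitary (X →L[ℂ] X)) : X →L[ℂ] X) *
      (v * A * star (v : X →L[ℂ] X)) * (v * u : unitary (X →L[ℂ] X))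
      = star (u : X →L[ℂ] X) * A * u := by
    calc _ = star (u : X →L[ℂ] X) * (star (v : X →L[ℂ] X) * v) * A *
          (star (v : X →L[ℂ] X) * v) * u := by
          simp only [Submonoid.coe_mul, star_mul, mul_assoc]
      _ = _ := by simp only [h1, mul_one]
  rw [h2]
  simp only [Submonoid.coe_mul, star_mul, mul_assoc]

theorem opTrace_unitaryTwirl_one [IsProbabilityMeasure μ] (B C : X →L[ℂ] X) :
    opTrace X (unitaryTwirl μ B C 1) = opTrace X B * opTrace X C := by
  rw [map_unitaryTwirl]
  simp [opTrace_unitary_conj]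

/-- The left side is the trace of the twirl as an operator on `L(X)`. For each `u` the integrand
sums to `Tr(uBu⋆ uCu⋆)`, which does not depend on `u`. -/
theorem sum_inner_unitaryTwirl_rankOne [IsProbabilityMeasure μ] {ι : Type*} [Fintype ι]
    (b : OrthonormalBasis ι ℂ X) (B C : X →L[ℂ] X) :
    ∑ i, ∑ j, inner ℂ (b i) (unitaryTwirl μ B C (rankOne ℂ (b i) (b j)) (b j)) =
      opTrace X (B * C) := by
  have h : ∀ i j, inner ℂ (b i) (unitaryTwirl μ B C (rankOne ℂ (b i) (b j)) (b j)) =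
      ∫ u : unitary (X →L[ℂ] X),
        opTrace X (B * (star (u : X →L[ℂ] X) * rankOne ℂ (b i) (b j) * u)) *
          inner ℂ (b i) ((u * C * star (u : X →L[ℂ] X)) (b j)) ∂μ := fun i j =>
    map_unitaryTwirl μ (innerSL ℂ (b i) ∘L ContinuousLinearMap.apply ℂ X (b j)) _ B C
  have hint : ∀ i j, Integrable (fun u : unitary (X →L[ℂ] X) =>
      opTrace X (B * (star (u : X →L[ℂ] X) * rankOne ℂ (b i) (b j) * u)) *
          inner ℂ (b i) ((u * C * star (u : X →L[ℂ] X)) (b j))) μ := fun i j =>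
    integrable_unitary_of_continuous μ (by fun_prop)
  simp only [h]
  simp_rw [← integral_finsetSum _ fun j _ => hint _ j]
  rw [← integral_finsetSum _ fun i _ => integrable_finsetSum _ fun j _ => hint i j]
  have hu : ∀ u : unitary (X →L[ℂ] X), ∑ i, ∑ j,
      opTrace X (B * (star (u : X →L[ℂ] X) * rankOne ℂ (b i) (b j) * u)) *
          inner ℂ (b i) ((u * C * star (u : X →L[ℂ] X)) (b j)) = opTrace X (B * C) := by
    intro u
    have h1 : ∀ i j, opTrace X (B * (star (u : X →L[ℂ] X) * rankOne ℂ (b i) (b j) * u)) =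
        inner ℂ (b j) ((u * B * star (u : X →L[ℂ] X)) (b i)) := by
      intro i j
      rw [← opTrace_rankOne_mul, opTrace_mul_comm, opTrace_mul_comm (rankOne ℂ (b i) (b j)),
        mul_assoc, mul_assoc, opTrace_mul_comm]
      simp only [mul_assoc]
      rw [← opTrace_mul_comm]
      simp only [mul_assoc]
    simp_rw [h1]
    rw [Finset.sum_comm]
    have h2 : ∀ j, ∑ i, inner ℂ (b j) ((u * B * star (u : X →L[ℂ] X)) (b i)) *
        inner ℂ (b i) ((u * C * star (u : X →L[ℂ] X)) (b j)) =
        inner ℂ (b j) ((u * (B * C) * star (u : X →L[ℂ] X)) (b j)) := by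
      intro j
      have : (u * (B * C) * star (u : X →L[ℂ] X)) =
          (u * B * star (u : X →L[ℂ] X)) * (u * C * star (u : X →L[ℂ] X)) := by
        calc _ = u * B * 1 * C * star (u : X →L[ℂ] X) := by simp only [mul_assoc, one_mul]
          _ = _ := by
            rw [← Unitary.coe_star_mul_self u]
            simp only [mul_assoc]
      rw [this, mul_apply_eq_comp _ (u * C * _), ← ContinuousLinearMap.adjoint_inner_left,
        ← b.sum_inner_mul_inner]
      simp only [ContinuousLinearMap.adjoint_inner_left]
    simp_rw [h2]
    rw [← opTrace_eq_sum, opTrace_unitary_conj]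
  simp_rw [hu]
  simp

/-- The two equations come from the trace of the value at `1` and the trace over `L(X)`. Their
determinant `d² - d⁴` is nonzero for `d ≥ 2`, so they then fix `s` and `t`. -/
theorem exists_unitaryTwirl_eq [IsProbabilityMeasure μ] [μ.IsMulLeftInvariant]
    (B C : X →L[ℂ] X) : ∃ s t : ℂ,
      (∀ A, unitaryTwirl μ B C A = s • A + (t * opTrace X A) • 1) ∧
      s * Module.finrank ℂ X + t * Module.finrank ℂ X ^ 2 = opTrace X B * opTrace X C ∧
      s * Module.finrank ℂ X ^ 2 + t * Module.finrank ℂ X = opTrace X (B * C) := by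
  obtain ⟨s, t, h⟩ := (isUnitarilyEquivariant_unitaryTwirl μ B C).exists_eq
  refine ⟨s, t, h, ?_, ?_⟩
  · rw [← opTrace_unitaryTwirl_one μ, h, ← opTrace_apply, map_add, map_smul, map_smul,
      opTrace_one]
    simp only [smul_eq_mul]
    ring
  · let b := stdOrthonormalBasis ℂ X
    rw [← sum_inner_unitaryTwirl_rankOne μ b]
    have : ∀ i j, inner ℂ (b i) (unitaryTwirl μ B C (rankOne ℂ (b i) (b j)) (b j)) =
        s + if i = j then t else 0 := by
      intro i j
      rw [h, ← opTrace_apply, opTrace_rankOne]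
      simp only [add_apply, smul_apply, rankOne_apply, one_apply_eq_self, inner_add_right,
        inner_smul_right, OrthonormalBasis.inner_eq_ite, eq_comm (a := j)]
      split_ifs <;> simp
    simp [this, Finset.sum_add_distrib]
    ring

end HaarTwirl

/-! ### Compactness of convex hulls. -/

/-- By Carathéodory, `finrank + 1` points suffice, so the hull is a continuous image of a simplex
times a power of `s`. -/
theorem IsCompact.convexHull_of_finiteDimensional {E : Type*} [NormedAddCommGroup E]
    [NormedSpace ℝ E] [FiniteDimensional ℝ E] {s : Set E} (hs : IsCompact s) :
    IsCompact (convexHull ℝ s) := by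
  rcases s.eq_empty_or_nonempty with rfl | ⟨a, ha⟩
  · simp
  let κ := Fin (Module.finrank ℝ E + 1)
  have hK : IsCompact (stdSimplex ℝ κ ×ˢ (Set.univ.pi fun _ : κ => s)) :=
    (isCompact_stdSimplex ℝ κ).prod (isCompact_univ_pi fun _ => hs)
  have hg : Continuous fun q : (κ → ℝ) × (κ → E) => ∑ i, q.1 i • q.2 i := by fun_prop
  convert hK.image hg using 1
  ext x
  constructor
  · intro hx
    obtain ⟨ι, hι, z, w, hz, hind, hw, hw1, rfl⟩ := eq_pos_convex_span_of_mem_convexHull hx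
    obtain ⟨e⟩ := Function.Embedding.nonempty_of_card_le (α := ι) (β := κ) (by
      simpa [κ] using hind.card_le_finrank_succ.trans
        (Nat.add_le_add_right (Submodule.finrank_le _) 1))
    -- Unused slots get weight zero and the arbitrary point `a` of `s`.
    refine ⟨(Function.extend e w 0, Function.extend e z fun _ => a), ⟨⟨?_, ?_⟩, ?_⟩, ?_⟩
    · intro j
      by_cases hj : ∃ i, e i = j
      · obtain ⟨i, rfl⟩ := hj
        simpa [e.injective.extend_apply] using (hw i).le
      · simp [Function.extend_apply' _ _ _ hj]
    · rw [← hw1]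
      exact (Fintype.sum_of_injective e e.injective _ _
        (fun j hj => by simp [Function.extend_apply' _ _ _ hj])
        (fun i => by simp [e.injective.extend_apply])).symm
    · intro j _
      by_cases hj : ∃ i, e i = j
      · obtain ⟨i, rfl⟩ := hj
        simpa [e.injective.extend_apply] using hz ⟨i, rfl⟩
      · simpa [Function.extend_apply' _ _ _ hj] using ha
    · exact (Fintype.sum_of_injective e e.injective _ _
        (fun j hj => by simp [Function.extend_apply' _ _ _ hj])
        (fun i => by simp [e.injective.extend_apply])).symm
  · rintro ⟨⟨w, z⟩, ⟨⟨hw, hw1⟩, hz⟩, rfl⟩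
    exact mem_convexHull_of_exists_fintype w z hw hw1 (fun i => hz i (Set.mem_univ i)) rfl

/-! ### The average weighted by the overlap with a channel. -/

section WeightedTwirl

open InnerProductSpace MeasureTheory

variable {X : Type*} [NormedAddCommGroup X] [InnerProductSpace ℂ X] [FiniteDimensional ℂ X]
  [CompleteSpace X] {ι : Type*} [Fintype ι]

/-- The Hilbert–Schmidt inner product of conjugation by `T` with the super-operator `Ψ`. -/
noncomputable def conjOverlap {Y : Type*} [NormedAddCommGroup Y] [InnerProductSpace ℂ Y]
    (b : OrthonormalBasis ι ℂ X) (Ψ : (X →L[ℂ] X) →ₗ[ℂ] (Y →L[ℂ] Y)) (T : X →L[ℂ] Y) : ℂ :=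
  ∑ i, ∑ j, inner ℂ (T (b i)) (Ψ (rankOne ℂ (b i) (b j)) (T (b j)))

omit [FiniteDimensional ℂ X] [CompleteSpace X] in
theorem continuous_conjOverlap {Y : Type*} [NormedAddCommGroup Y] [InnerProductSpace ℂ Y]
    (b : OrthonormalBasis ι ℂ X) (Ψ : (X →L[ℂ] X) →ₗ[ℂ] (Y →L[ℂ] Y)) :
    Continuous (conjOverlap b Ψ) := by
  unfold conjOverlap
  fun_prop

variable (μ : Measure (unitary (X →L[ℂ] X)))

theorem integral_conjOverlap_smul [IsProbabilityMeasure μ] [μ.IsMulLeftInvariant]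
    (b : OrthonormalBasis ι ℂ X) {Ψ : (X →L[ℂ] X) →ₗ[ℂ] (X →L[ℂ] X)}
    (htr : ∀ A, opTrace X (Ψ A) = opTrace X A) (hone : Ψ 1 = 1) {d : ℕ}
    (hd : Module.finrank ℂ X = d) (hd2 : 2 ≤ d) (C : X →L[ℂ] X) :
    ∫ u : unitary (X →L[ℂ] X),
        conjOverlap b Ψ (u : X →L[ℂ] X) • (u * C * star (u : X →L[ℂ] X)) ∂μ =
      (1 / ((d : ℂ) ^ 2 - 1)) • Ψ C +
        ((1 - 1 / ((d : ℂ) ^ 2 - 1)) * (opTrace X C / d)) • 1 := by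
  classical
  have hd0 : (d : ℂ) ≠ 0 := by exact_mod_cast (by omega : d ≠ 0)
  have hd1 : (d : ℂ) ^ 2 - 1 ≠ 0 := by
    rw [sub_ne_zero]
    exact_mod_cast (by nlinarith : d ^ 2 ≠ 1)
  set k : ℂ := 1 / ((d : ℂ) ^ 2 - 1) with hk
  have hk1 : k * ((d : ℂ) ^ 2 - 1) = 1 := by rw [hk]; field_simp
  have h1 : ∀ u : unitary (X →L[ℂ] X),
      conjOverlap b Ψ (u : X →L[ℂ] X) • (u * C * star (u : X →L[ℂ] X)) =
      ∑ i, ∑ j, opTrace X (rankOne ℂ (b j) (b i) *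
        (star (u : X →L[ℂ] X) * Ψ (rankOne ℂ (b i) (b j)) * u)) •
          (u * C * star (u : X →L[ℂ] X)) := by
    intro u
    simp only [conjOverlap, Finset.sum_smul, opTrace_rankOne_mul, mul_apply_eq_comp,
      ContinuousLinearMap.star_eq_adjoint, ContinuousLinearMap.adjoint_inner_right]
  simp_rw [h1]
  rw [integral_finsetSum _ fun i _ => integrable_finsetSum _ fun j _ =>
    integrable_unitary_of_continuous μ (by fun_prop)]
  simp_rw [integral_finsetSum Finset.univ fun j _ =>
    integrable_unitary_of_continuous μ (continuous_unitary_conj_kernel _ _ C),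
    ← unitaryTwirl_apply]
  -- Solved values of `s` and `t` for `B = E_ji`, `A = Ψ(E_ij)`. Off the diagonal both `B` and `A`
  -- are traceless, so only `s` survives. The first terms sum to `k Ψ(C)`; the diagonal corrections
  -- involve `∑ Ψ(E_ii) = Ψ(1) = 1`.
  have h2 : ∀ i j, unitaryTwirl μ (rankOne ℂ (b j) (b i)) C (Ψ (rankOne ℂ (b i) (b j))) =
      k • (inner ℂ (b i) (C (b j)) • Ψ (rankOne ℂ (b i) (b j))) +
        if i = j then (-(k * opTrace X C / d)) • Ψ (rankOne ℂ (b i) (b j)) +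
          ((opTrace X C - (k * (inner ℂ (b i) (C (b i)) - opTrace X C / d)) * d) / d ^ 2) • 1
        else 0 := by
    intro i j
    obtain ⟨s, t, h, hs1, hs2⟩ := exists_unitaryTwirl_eq μ (rankOne ℂ (b j) (b i)) C
    rw [h, htr]
    rw [hd, opTrace_rankOne, b.inner_eq_ite] at hs1
    rw [hd, opTrace_rankOne_mul] at hs2
    rw [opTrace_rankOne, b.inner_eq_ite]
    by_cases hij : i = j
    · subst hij
      simp only [if_true, one_mul, mul_one] at hs1 hs2 ⊢
      have e1 : s = k * (inner ℂ (b i) (C (b i)) - opTrace X C / d) := by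
        have : s * ((d : ℂ) ^ 2 - 1) = inner ℂ (b i) (C (b i)) - opTrace X C / d := by
          rw [← hs1, ← hs2]; field_simp; ring
        rw [← this]; linear_combination (-s) * hk1
      have e2 : t = (opTrace X C - s * d) / d ^ 2 := by
        rw [← hs1]; field_simp; ring
      rw [e2, e1]
      module
    · simp only [if_neg hij, if_neg (Ne.symm hij), zero_mul, mul_zero, zero_smul, add_zero]
        at hs1 hs2 ⊢
      have e1 : s = k * inner ℂ (b i) (C (b j)) := by
        have : s * ((d : ℂ) ^ 2 - 1) = inner ℂ (b i) (C (b j)) := by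
          rw [← hs2]
          have : t * d = -s := by
            have : (t * d + s) * d = 0 := by linear_combination hs1
            rcases mul_eq_zero.1 this with h | h
            · linear_combination h
            · exact absurd h hd0
          linear_combination -this
        rw [← this]; linear_combination (-s) * hk1
      rw [e1, smul_smul]
  simp_rw [h2, Finset.sum_add_distrib, Finset.sum_ite_eq, Finset.mem_univ, if_true,
    Finset.sum_add_distrib, ← Finset.smul_sum, ← Finset.sum_smul, ← map_smul, ← map_sum]
  have hid : ∑ i, rankOne ℂ (b i) (b i) = (1 : X →L[ℂ] X) := b.sum_rankOne_eq_id
  have hC : ∑ i, ∑ j, inner ℂ (b i) (C (b j)) • rankOne ℂ (b i) (b j) = C := by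
    rw [Finset.sum_comm]
    calc _ = ∑ j, C * rankOne ℂ (b j) (b j) := by
          refine Finset.sum_congr rfl fun j _ => ?_
          rw [ContinuousLinearMap.mul_def, comp_rankOne]
          conv_rhs => rw [← b.sum_repr' (C (b j))]
          simp
      _ = C := by rw [← Finset.mul_sum, hid, mul_one]
  have hcard : (Fintype.card ι : ℂ) = d := by
    rw [← hd, Module.finrank_eq_card_basis b.toBasis]
  have hsum : ∑ i, (opTrace X C - (k * (inner ℂ (b i) (C (b i)) - opTrace X C / d)) * d) / d ^ 2
      = opTrace X C / d := by
    rw [← Finset.sum_div, Finset.sum_sub_distrib, ← Finset.sum_mul, ← Finset.mul_sum,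
      Finset.sum_sub_distrib, ← opTrace_eq_sum]
    simp only [Finset.sum_const, Finset.card_univ, nsmul_eq_mul, hcard]
    field_simp
    ring
  rw [hC, hid, hone, hsum, map_smul]
  module

theorem integral_conjOverlap [IsProbabilityMeasure μ] [μ.IsMulLeftInvariant]
    (b : OrthonormalBasis ι ℂ X) {Ψ : (X →L[ℂ] X) →ₗ[ℂ] (X →L[ℂ] X)}
    (htr : ∀ A, opTrace X (Ψ A) = opTrace X A) (hone : Ψ 1 = 1) {d : ℕ}
    (hd : Module.finrank ℂ X = d) (hd2 : 2 ≤ d) :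
    ∫ u : unitary (X →L[ℂ] X), conjOverlap b Ψ (u : X →L[ℂ] X) ∂μ = 1 := by
  have hd0 : (d : ℂ) ≠ 0 := by exact_mod_cast (by omega : d ≠ 0)
  -- At `C = 1` the conjugated operator is constantly `1`, leaving the integral of the weight.
  have h := integral_conjOverlap_smul μ b htr hone hd hd2 1
  have hu : ∀ u : unitary (X →L[ℂ] X), (u : X →L[ℂ] X) * star (u : X →L[ℂ] X) = 1 := fun u =>
    Unitary.mul_star_self_of_mem u.2
  simp only [mul_one, hu] at h
  rw [integral_smul_const, hone, opTrace_one, hd, div_self hd0, ← add_smul] at h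
  have h2 := congrArg (opTrace X) h
  simp only [map_smul, opTrace_one, hd, smul_eq_mul] at h2
  have := mul_right_cancel₀ hd0 h2
  rw [this]
  ring

end WeightedTwirl

/-! ### Positivity of the weight, and averages as finite mixtures. -/

section MixedUnitary

open InnerProductSpace MeasureTheory
open scoped ComplexOrder

variable {X Y : Type*}
  [NormedAddCommGroup X] [InnerProductSpace ℂ X] [FiniteDimensional ℂ X] [CompleteSpace X]
  [NormedAddCommGroup Y] [InnerProductSpace ℂ Y] [FiniteDimensional ℂ Y] [CompleteSpace Y]

theorem exists_eq_star_mul_self_of_nonneg {A : Type*} [NonUnitalCStarAlgebra A] [PartialOrder A]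
    [StarOrderedRing A] {a : A} (ha : 0 ≤ a) : ∃ b, a = star b * b :=
  CStarAlgebra.nonneg_iff_eq_star_mul_self.1 ha

omit [FiniteDimensional ℂ X] in
theorem cstarMatrix_rankOne_nonneg {ι : Type*} [Fintype ι] (b : OrthonormalBasis ι ℂ X) :
    0 ≤ (CStarMatrix.ofMatrix (Matrix.of fun i j => rankOne ℂ (b i) (b j)) :
      CStarMatrix ι ι (X →L[ℂ] X)) := by
  classical
  rcases isEmpty_or_nonempty ι with hι | ⟨⟨i₀⟩⟩
  · exact le_of_eq (CStarMatrix.ext fun i => hι.elim i)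
  have hM : (CStarMatrix.ofMatrix (Matrix.of fun i j => rankOne ℂ (b i) (b j)) :
      -- The factor has a single nonzero row `i₀`, with entries `E_{i₀ j}`, and `E_{i₀ i}⋆ E_{i₀ j}
      -- = E_ij`.
      CStarMatrix ι ι (X →L[ℂ] X)) =
      star (CStarMatrix.ofMatrix
        (Matrix.of fun i j => if i = i₀ then rankOne ℂ (b i₀) (b j) else 0)) *
      CStarMatrix.ofMatrix
        (Matrix.of fun i j => if i = i₀ then rankOne ℂ (b i₀) (b j) else 0) := by
    ext i j : 2
    rw [CStarMatrix.mul_apply]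
    simp only [CStarMatrix.star_apply]
    rw [Finset.sum_eq_single i₀]
    · simp [ContinuousLinearMap.star_eq_adjoint, ContinuousLinearMap.mul_def, comp_rankOne]
    · intro k _ hk
      simp [hk]
    · simp
  rw [hM]
  exact star_mul_self_nonneg _

omit [FiniteDimensional ℂ X] [FiniteDimensional ℂ Y] in
theorem IsCompletelyPositive.exists_apply_rankOne_eq {Φ : (X →L[ℂ] X) →ₗ[ℂ] (Y →L[ℂ] Y)}
    (hΦ : IsCompletelyPositive Φ) {ι : Type*} [Fintype ι] (b : OrthonormalBasis ι ℂ X) :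
    ∃ N : ι → ι → (Y →L[ℂ] Y),
      ∀ i j, Φ (rankOne ℂ (b i) (b j)) = ∑ k, star (N k i) * N k j := by
  obtain ⟨F, rfl⟩ := hΦ
  obtain ⟨N, hN⟩ := exists_eq_star_mul_self_of_nonneg
    (F.map_cstarMatrix_nonneg _ (cstarMatrix_rankOne_nonneg b))
  refine ⟨fun k i => N k i, fun i j => ?_⟩
  have h := congrFun (congrFun hN i) j
  rw [CStarMatrix.mul_apply] at h
  exact h

-- Factoring the positive matrix `Φ(E_ij)` as `N⋆N` turns the overlap into `∑_k ‖∑_i N_ki T b_i‖²`.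
omit [FiniteDimensional ℂ X] [FiniteDimensional ℂ Y] in
theorem IsCompletelyPositive.conjOverlap_nonneg {Φ : (X →L[ℂ] X) →ₗ[ℂ] (Y →L[ℂ] Y)}
    (hΦ : IsCompletelyPositive Φ) {ι : Type*} [Fintype ι] (b : OrthonormalBasis ι ℂ X)
    (T : X →L[ℂ] Y) : 0 ≤ conjOverlap b Φ T := by
  obtain ⟨N, hN⟩ := hΦ.exists_apply_rankOne_eq b
  have : conjOverlap b Φ T =
      ∑ k, inner ℂ (∑ i, N k i (T (b i))) (∑ i, N k i (T (b i))) := by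
    simp only [conjOverlap, hN, sum_apply, mul_apply_eq_comp, ContinuousLinearMap.star_eq_adjoint,
      ContinuousLinearMap.adjoint_inner_right, inner_sum]
    simp_rw [sum_inner]
    exact (Finset.sum_congr rfl fun i _ => Finset.sum_comm).trans
      (Finset.sum_comm.trans (Finset.sum_congr rfl fun k _ => Finset.sum_comm))
  rw [this]
  refine Finset.sum_nonneg fun k _ => ?_
  rw [inner_self_eq_norm_sq_to_K]
  exact pow_nonneg (RCLike.ofReal_nonneg.2 (norm_nonneg _)) 2

/-- Conjugation `A ↦ T A T⋆` by an operator `T`. -/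
noncomputable def conjBy (T : X →L[ℂ] Y) : (X →L[ℂ] X) →L[ℂ] (Y →L[ℂ] Y) :=
  (ContinuousLinearMap.compL ℂ Y X Y).flip (ContinuousLinearMap.adjoint T) ∘L
    ContinuousLinearMap.compL ℂ X X Y T

omit [FiniteDimensional ℂ X] [FiniteDimensional ℂ Y] in
theorem conjBy_apply (T : X →L[ℂ] Y) (A : X →L[ℂ] X) :
    conjBy T A = T ∘L A ∘L ContinuousLinearMap.adjoint T := rfl

omit [FiniteDimensional ℂ X] [FiniteDimensional ℂ Y] in
theorem continuous_conjBy : Continuous (conjBy : (X →L[ℂ] Y) → _) := by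
  unfold conjBy
  fun_prop

/-- The convex hull of all conjugations by unitary maps. -/
def unitaryConjHull (X Y : Type*)
    [NormedAddCommGroup X] [InnerProductSpace ℂ X] [FiniteDimensional ℂ X] [CompleteSpace X]
    [NormedAddCommGroup Y] [InnerProductSpace ℂ Y] [FiniteDimensional ℂ Y] [CompleteSpace Y] :
    Set ((X →L[ℂ] X) →L[ℂ] (Y →L[ℂ] Y)) :=
  convexHull ℝ (Set.range fun U : X ≃ₗᵢ[ℂ] Y => conjBy (U : X →L[ℂ] Y))

omit [FiniteDimensional ℂ X] [FiniteDimensional ℂ Y] in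
theorem range_conjBy_eq (e : X ≃ₗᵢ[ℂ] Y) :
    (Set.range fun U : X ≃ₗᵢ[ℂ] Y => conjBy (U : X →L[ℂ] Y)) =
      Set.range fun u : unitary (X →L[ℂ] X) => conjBy ((e : X →L[ℂ] Y) ∘L (u : X →L[ℂ] X)) := by
  ext S
  constructor
  · rintro ⟨U, rfl⟩
    refine ⟨Unitary.linearIsometryEquiv.symm (U.trans e.symm), ?_⟩
    exact congrArg conjBy (ContinuousLinearMap.ext fun x => e.apply_symm_apply (U x))
  · rintro ⟨u, rfl⟩
    exact ⟨(Unitary.linearIsometryEquiv u).trans e,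
      congrArg conjBy (ContinuousLinearMap.ext fun x => rfl)⟩

theorem isClosed_unitaryConjHull (e : X ≃ₗᵢ[ℂ] Y) : IsClosed (unitaryConjHull X Y) := by
  have := compactSpace_unitary (X := X)
  have : FiniteDimensional ℝ ((X →L[ℂ] X) →L[ℂ] (Y →L[ℂ] Y)) := FiniteDimensional.complexToReal _
  rw [unitaryConjHull, range_conjBy_eq e]
  exact (isCompact_range (continuous_conjBy.comp (by fun_prop))).convexHull_of_finiteDimensional
    |>.isClosed

theorem isMixedUnitary_of_mem_unitaryConjHull {S : (X →L[ℂ] X) →L[ℂ] (Y →L[ℂ] Y)}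
    (hS : S ∈ unitaryConjHull X Y) {Φ : (X →L[ℂ] X) →ₗ[ℂ] (Y →L[ℂ] Y)} (h : ∀ A, Φ A = S A) :
    IsMixedUnitary Φ := by
  obtain ⟨κ, hκ, w, z, hw, hw1, hz, rfl⟩ := mem_convexHull_iff_exists_fintype.1 hS
  choose U hU using hz
  let ε := (Fintype.equivFin κ).symm
  refine ⟨Fintype.card κ, w ∘ ε, U ∘ ε, fun i => hw _, ?_, fun A => ?_⟩
  · rw [← hw1]
    exact ε.sum_comp w
  · rw [h, sum_apply]
    refine (ε.sum_comp _).symm.trans (Finset.sum_congr rfl fun i _ => ?_)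
    simp only [smul_apply, ← hU]
    rfl

theorem integral_mem_unitaryConjHull (e : X ≃ₗᵢ[ℂ] Y) (μ : Measure (unitary (X →L[ℂ] X)))
    [IsFiniteMeasure μ] {f : unitary (X →L[ℂ] X) → ℂ} (hf : Continuous f) (hf0 : ∀ u, 0 ≤ f u)
    (hf1 : ∫ u, f u ∂μ = 1) :
    ∫ u, f u • conjBy ((e : X →L[ℂ] Y) ∘L (u : X →L[ℂ] X)) ∂μ ∈ unitaryConjHull X Y := by
  have hre : ∀ u, f u = ((f u).re : ℂ) := fun u => Complex.eq_re_of_ofReal_le (r := 0) (hf0 u)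
  have hre0 : ∀ u, 0 ≤ (f u).re := fun u => (Complex.le_def.1 (hf0 u)).1
  let g : unitary (X →L[ℂ] X) → NNReal := fun u => (f u).re.toNNReal
  have hgc : Continuous g := by fun_prop
  have hg : ∀ u, ((g u : ℝ) : ℂ) = f u := fun u => by
    rw [hre u, Real.coe_toNNReal _ (by simpa using hre0 u)]
  have hint : Integrable (fun u => (g u : ℝ)) μ := integrable_unitary_of_continuous μ (by fun_prop)
  -- The weight is absorbed into the measure, so that a probability average stays in the closed
  -- convex hull.
  have hprob : IsProbabilityMeasure (μ.withDensity fun u => (g u : ENNReal)) := by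
    refine ⟨?_⟩
    rw [withDensity_apply _ MeasurableSet.univ, Measure.restrict_univ,
      lintegral_coe_eq_integral _ hint, ENNReal.ofReal_eq_one]
    have : ((∫ u, (g u : ℝ) ∂μ : ℝ) : ℂ) = 1 := by
      rw [← integral_complex_ofReal, ← hf1]
      simp only [hg]
    exact_mod_cast this
  have hcont : Continuous fun u : unitary (X →L[ℂ] X) =>
      conjBy ((e : X →L[ℂ] Y) ∘L (u : X →L[ℂ] X)) := continuous_conjBy.comp (by fun_prop)
  have hmem := (convex_convexHull ℝ _).integral_mem
    (μ := μ.withDensity fun u => (g u : ENNReal)) (isClosed_unitaryConjHull e)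
    (f := fun u : unitary (X →L[ℂ] X) => conjBy ((e : X →L[ℂ] Y) ∘L (u : X →L[ℂ] X)))
    (Filter.Eventually.of_forall fun u => subset_convexHull ℝ _ (by
      rw [range_conjBy_eq e]; exact ⟨u, rfl⟩))
    (integrable_unitary_of_continuous _ hcont)
  rw [integral_withDensity_eq_integral_smul hgc.measurable] at hmem
  have heq : (fun u : unitary (X →L[ℂ] X) => f u • conjBy ((e : X →L[ℂ] Y) ∘L (u : X →L[ℂ] X))) =
      fun u => g u • conjBy ((e : X →L[ℂ] Y) ∘L (u : X →L[ℂ] X)) := by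
    ext1 u
    rw [← hg u]
    rfl
  rw [heq]
  exact hmem

end MixedUnitary

/-! ### The endpoint mixture and the depolarizing channel. -/

section DepolarizedMixture

open InnerProductSpace MeasureTheory
open scoped ComplexOrder

variable {X Y : Type*}
  [NormedAddCommGroup X] [InnerProductSpace ℂ X] [FiniteDimensional ℂ X] [CompleteSpace X]
  [NormedAddCommGroup Y] [InnerProductSpace ℂ Y] [FiniteDimensional ℂ Y] [CompleteSpace Y]

omit [FiniteDimensional ℂ X] [FiniteDimensional ℂ Y] in
theorem adjoint_coe_linearIsometryEquiv (e : X ≃ₗᵢ[ℂ] Y) :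
    ContinuousLinearMap.adjoint (e : X →L[ℂ] Y) = (e.symm : Y →L[ℂ] X) := by
  ext y
  refine ext_inner_right ℂ fun x => ?_
  rw [ContinuousLinearMap.adjoint_inner_left]
  exact (e.symm.inner_map_eq_flip y x).symm

omit [FiniteDimensional ℂ X] [FiniteDimensional ℂ Y] in
theorem conjBy_linearIsometryEquiv_apply (e : X ≃ₗᵢ[ℂ] Y) (A : X →L[ℂ] X) (y : Y) :
    conjBy (e : X →L[ℂ] Y) A y = e (A (e.symm y)) := by
  rw [conjBy_apply, adjoint_coe_linearIsometryEquiv]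
  rfl

theorem opTrace_conjBy_linearIsometryEquiv (e : X ≃ₗᵢ[ℂ] Y) (A : X →L[ℂ] X) :
    opTrace Y (conjBy (e : X →L[ℂ] Y) A) = opTrace X A := by
  rw [opTrace_apply, opTrace_apply, ← LinearMap.trace_conj' (A : X →ₗ[ℂ] X) e.toLinearEquiv]
  congr 1
  ext y
  exact conjBy_linearIsometryEquiv_apply e A y

/-- Only nonnegative overlaps are asked of `Φ`, so the result also applies to `Ω`, whose overlaps
are visibly nonnegative. -/
theorem exists_mem_unitaryConjHull_eq (e : X ≃ₗᵢ[ℂ] Y) {Φ : (X →L[ℂ] X) →ₗ[ℂ] (Y →L[ℂ] Y)}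
    (htr : IsTracePreserving Φ) (hone : Φ 1 = 1)
    (hnonneg : ∀ T : X →L[ℂ] Y, 0 ≤ conjOverlap (stdOrthonormalBasis ℂ X) Φ T) {d : ℕ}
    (hd : Module.finrank ℂ X = d) (hd2 : 2 ≤ d) :
    ∃ S ∈ unitaryConjHull X Y, ∀ A, S A = (1 / ((d : ℂ) ^ 2 - 1)) • Φ A +
        ((1 - 1 / ((d : ℂ) ^ 2 - 1)) * (opTrace X A / d)) • 1 := by
  obtain ⟨μ, hμ, hinv⟩ := exists_invariant_probability_unitary (X := X)
  let b := stdOrthonormalBasis ℂ X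
  let Ψ : (X →L[ℂ] X) →ₗ[ℂ] (X →L[ℂ] X) :=
    (conjBy (e.symm : Y →L[ℂ] X) : (Y →L[ℂ] Y) →ₗ[ℂ] (X →L[ℂ] X)) ∘ₗ Φ
  have hΨ : ∀ A x, Ψ A x = e.symm (Φ A (e x)) := fun A x =>
    conjBy_linearIsometryEquiv_apply e.symm (Φ A) x
  have hΨtr : ∀ A, opTrace X (Ψ A) = opTrace X A := fun A =>
    (opTrace_conjBy_linearIsometryEquiv e.symm (Φ A)).trans (htr A)
  have hΨone : Ψ 1 = 1 := by
    ext x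
    rw [hΨ, hone]
    simp
  have hov : ∀ u : X →L[ℂ] X, conjOverlap b Ψ u = conjOverlap b Φ ((e : X →L[ℂ] Y) ∘L u) := by
    intro u
    simp only [conjOverlap, hΨ]
    refine Finset.sum_congr rfl fun i _ => Finset.sum_congr rfl fun j _ => ?_
    rw [← e.inner_map_map, e.apply_symm_apply]
    rfl
  have hcont : Continuous fun u : unitary (X →L[ℂ] X) => conjOverlap b Ψ (u : X →L[ℂ] X) :=
    (continuous_conjOverlap b Ψ).comp continuous_subtype_val
  refine ⟨_, integral_mem_unitaryConjHull e μ hcont (fun u => hov u ▸ hnonneg _)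
    (integral_conjOverlap μ b hΨtr hΨone hd hd2), fun A => ?_⟩
  have hint : Integrable (fun u : unitary (X →L[ℂ] X) => conjOverlap b Ψ (u : X →L[ℂ] X) •
      conjBy ((e : X →L[ℂ] Y) ∘L (u : X →L[ℂ] X))) μ :=
    integrable_unitary_of_continuous μ (hcont.smul (continuous_conjBy.comp (by fun_prop)))
  have hint' : Integrable (fun u : unitary (X →L[ℂ] X) => conjOverlap b Ψ (u : X →L[ℂ] X) •
      ((u : X →L[ℂ] X) * A * star (u : X →L[ℂ] X))) μ :=
    integrable_unitary_of_continuous μ (hcont.smul (by fun_prop))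
  have hcomp : ∀ u : unitary (X →L[ℂ] X),
      (conjOverlap b Ψ (u : X →L[ℂ] X) • conjBy ((e : X →L[ℂ] Y) ∘L (u : X →L[ℂ] X))) A =
      conjBy (e : X →L[ℂ] Y) (conjOverlap b Ψ (u : X →L[ℂ] X) •
        ((u : X →L[ℂ] X) * A * star (u : X →L[ℂ] X))) := by
    intro u
    rw [map_smul, smul_apply, conjBy_apply, conjBy_apply, ContinuousLinearMap.adjoint_comp]
    rfl
  rw [ContinuousLinearMap.integral_apply hint]
  simp_rw [hcomp]
  rw [ContinuousLinearMap.integral_comp_comm _ hint',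
    integral_conjOverlap_smul μ b hΨtr hΨone hd hd2, map_add, map_smul, map_smul]
  have h1 : conjBy (e : X →L[ℂ] Y) (Ψ A) = Φ A := by
    ext y
    rw [conjBy_linearIsometryEquiv_apply, hΨ]
    simp
  have h2 : conjBy (e : X →L[ℂ] Y) 1 = 1 := by
    ext y
    rw [conjBy_linearIsometryEquiv_apply]
    simp
  rw [h1, h2]

omit [CompleteSpace X] [FiniteDimensional ℂ Y] [CompleteSpace Y] in
theorem completelyDepolarizing_apply (A : X →L[ℂ] X) :
    completelyDepolarizing X Y A = (opTrace X A / (Module.finrank ℂ Y : ℂ)) • 1 := rfl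

omit [CompleteSpace X] [FiniteDimensional ℂ Y] [CompleteSpace Y] in
theorem conjOverlap_completelyDepolarizing_nonneg {ι : Type*} [Fintype ι]
    (b : OrthonormalBasis ι ℂ X) (T : X →L[ℂ] Y) :
    0 ≤ conjOverlap b (completelyDepolarizing X Y) T := by
  classical
  refine Finset.sum_nonneg fun i _ => Finset.sum_nonneg fun j _ => ?_
  rw [completelyDepolarizing_apply, opTrace_rankOne, b.inner_eq_ite]
  split_ifs with h
  · subst h
    rw [smul_apply, one_apply_eq_self, inner_smul_right, inner_self_eq_norm_sq_to_K]
    exact mul_nonneg (div_nonneg zero_le_one (Nat.cast_nonneg _))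
      (pow_nonneg (RCLike.ofReal_nonneg.2 (norm_nonneg _)) 2)
  · simp

omit [CompleteSpace X] in
theorem exists_eq_smul_one_of_finrank_le_one (h : Module.finrank ℂ X ≤ 1) (A : X →L[ℂ] X) :
    ∃ c : ℂ, A = c • 1 := by
  obtain ⟨v, hv⟩ := finrank_le_one_iff.1 h
  obtain ⟨c, hc⟩ := hv (A v)
  refine ⟨c, ?_⟩
  ext w
  obtain ⟨k, rfl⟩ := hv w
  rw [map_smul, ← hc, smul_apply, one_apply_eq_self, smul_comm]

end DepolarizedMixture

theorem theorem1 {X Y : Type*}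
    [NormedAddCommGroup X] [InnerProductSpace ℂ X] [FiniteDimensional ℂ X] [CompleteSpace X]
    [NormedAddCommGroup Y] [InnerProductSpace ℂ Y] [FiniteDimensional ℂ Y] [CompleteSpace Y]
    (d : ℕ) (hX : Module.finrank ℂ X = d) (hY : Module.finrank ℂ Y = d)
    (Φ : (X →L[ℂ] X) →ₗ[ℂ] (Y →L[ℂ] Y)) (hΦ : IsDoublyStochastic Φ)
    (p : ℝ) (hp0 : 0 ≤ p) (hp1 : ((d : ℝ) ^ 2 - 1) * p ≤ 1) :
    IsMixedUnitary (p • Φ + (1 - p) • completelyDepolarizing X Y) := by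
  let e : X ≃ₗᵢ[ℂ] Y := 
    (stdOrthonormalBasis ℂ X).equiv (stdOrthonormalBasis ℂ Y) (finCongr (hX.trans hY.symm))
  have happly : ∀ A, (p • Φ + (1 - p) • completelyDepolarizing X Y) A =
      (p : ℂ) • Φ A + ((1 - p : ℂ) * (opTrace X A / d)) • 1 := by
    intro A
    rw [LinearMap.add_apply, LinearMap.smul_apply, LinearMap.smul_apply,
      completelyDepolarizing_apply, hY, ← Complex.coe_smul, ← Complex.coe_smul, smul_smul]
    push_cast
    rfl
  -- For `d ≤ 1` every operator is scalar, and conjugation by `e` alone already gives the map.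
  rcases Nat.lt_or_ge d 2 with hd | hd
  · refine isMixedUnitary_of_mem_unitaryConjHull (S := conjBy (e : X →L[ℂ] Y))
      (subset_convexHull ℝ _ ⟨e, rfl⟩) fun A => ?_
    obtain ⟨c, rfl⟩ := exists_eq_smul_one_of_finrank_le_one (by omega) A
    have h2 : conjBy (e : X →L[ℂ] Y) 1 = 1 := by
      ext y
      rw [conjBy_linearIsometryEquiv_apply]
      simp
    rw [happly, map_smul, map_smul, map_smul, h2, hΦ.unital, opTrace_one, hX]
    interval_cases d
    · have : Subsingleton Y := Module.finrank_zero_iff.1 hY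
      exact Subsingleton.elim _ _
    · simp only [Nat.cast_one, div_one, smul_eq_mul, mul_one]
      module
  have hd0 : (d : ℂ) ≠ 0 := by exact_mod_cast (by omega : d ≠ 0)
  have hd1 : (d : ℂ) ^ 2 - 1 ≠ 0 := by
    rw [sub_ne_zero]
    exact_mod_cast (by nlinarith : d ^ 2 ≠ 1)
  have hd1' : (0 : ℝ) ≤ (d : ℝ) ^ 2 - 1 := by
    have : (2 : ℝ) ≤ d := by exact_mod_cast hd
    nlinarith
  obtain ⟨S, hS, hSA⟩ := exists_mem_unitaryConjHull_eq e hΦ.tracePreserving hΦ.unital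
    (hΦ.completelyPositive.conjOverlap_nonneg _) hX hd
  -- Since `k Ω + (1-k) Ω = Ω`, the element `Z` is `Ω` itself.
  obtain ⟨Z, hZ, hZA⟩ := exists_mem_unitaryConjHull_eq e (Φ := completelyDepolarizing X Y)
    (fun A => by
      rw [← opTrace_apply, ← opTrace_apply, completelyDepolarizing_apply, map_smul, opTrace_one, hY, smul_eq_mul,
        div_mul_cancel₀ _ hd0])
    (by rw [completelyDepolarizing_apply, opTrace_one, hX, hY, div_self hd0, one_smul])
    (conjOverlap_completelyDepolarizing_nonneg _) hX hd
  -- Weight `(d²-1) p` on the endpoint `S` produces the coefficient `p` of `Φ`; the rest goes to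
  -- `Z`.
  refine isMixedUnitary_of_mem_unitaryConjHull
    (convex_convexHull ℝ _ hS hZ (mul_nonneg hd1' hp0) (sub_nonneg.2 hp1)
      (add_sub_cancel _ _)) fun A => ?_
  rw [happly, add_apply, smul_apply, smul_apply, hSA, hZA, completelyDepolarizing_apply, hY,
    ← Complex.coe_smul, ← Complex.coe_smul]
  push_cast
  simp only [smul_add, smul_smul]
  have h1 : ((d : ℂ) ^ 2 - 1) * p * (1 / ((d : ℂ) ^ 2 - 1)) = p := by field_simp
  rw [h1, add_assoc, ← add_smul, ← add_smul]
  congr 2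
  linear_combination (opTrace X A / d) * h1
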